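/- Let $G=(V,E,m,\mu)$ be a weighted graph: $(V,E)$ is a connected, undirected, locally finite graph (every vertex has finitely many neighbours), with vertex weights $m:V\to(0,\infty)$ and symmetric edge weights $\mu_{xy}=\mu_{yx}>0$ for $\{x,y\}\in E$. Write $x\sim y$ if $\{x,y\}\in E$. For $f,g:V\to\mathbb{R}$ put $$\Delta f(x)=\frac1{m(x)}\sum_{y\sim x}\mu_{xy}\,(f(y)-f(x)),\qquad \Gamma(f,g)=\tfrac12\big(\Delta(fg)-f\Delta g-g\Delta f\big),\qquad \Gamma(f)=\Gamma(f,f),$$ $$\Gamma_2(f)=\tfrac12\Delta\Gamma(f)-\Gamma(f,\Delta f).$$ Assume that (A) either $(A_1)$ $\Delta$ is a bounded operator on $\ell^2(V,m)$ (equivalently, $\sup_{x\in V}\frac1{m(x)}\sum_{y\sim x}\mu_{xy}<\infty$), or $(A_2)$ $\inf_{x\in V}m(x)>0$ and $G$ is complete, i.e. there is a non-decreasing sequence $(\eta_k)_{k\ge1}$ of finitely supported non-negative functions on $V$ with $\lim_{k\to\infty}\eta_k=1$ pointwise and $\Gamma(\eta_k)\le\frac1k$ on $V$ for all $k\ge1$.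 Assume also that $G$ satisfies the Bakry–Émery curvature dimension condition $\mathrm{CD}(0,\infty)$, i.e. $\Gamma_2(f)(x)\ge0$ for all $f:V\to\mathbb{R}$ and all $x\in V$. Then every bounded function $f:V\to\mathbb{R}$ that is harmonic on $G$, i.e. satisfies $\Delta f(x)=0$ for all $x\in V$, is constant. -/

import Mathlib

open Filter Topology
open scoped ENNReal

/-- A locally finite weighted graph `(V, E, m, μ)`: a simple undirected graph in which every vertex
has finitely many neighbours, with vertex weights `m : V → (0,∞)` and symmetric edge weights
`μ x y = μ y x`, positive on edges (and `0` on pairs that are not edges). -/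
structure WeightedGraph (V : Type*) where
  graph : SimpleGraph V
  locallyFinite : ∀ x, (graph.neighborSet x).Finite
  m : V → ℝ
  m_pos : ∀ x, 0 < m x
  μ : V → V → ℝ
  μ_symm : ∀ x y, μ x y = μ y x
  μ_pos : ∀ x y, graph.Adj x y → 0 < μ x y
  μ_eq_zero : ∀ x y, ¬ graph.Adj x y → μ x y = 0

namespace WeightedGraph

/-- The finite set of neighbours of a vertex. -/
noncomputable def neighbors {V : Type*} (G : WeightedGraph V) (x : V) : Finset V :=
  (G.locallyFinite x).toFinset

/-- The Laplacian `Δ f(x) = (1/m(x)) ∑_{y ∼ x} μ_{xy} (f(y) - f(x))`, for every `f : V → ℝ`. -/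
noncomputable def laplacian {V : Type*} (G : WeightedGraph V) (f : V → ℝ) : V → ℝ :=
  fun x => 1 / G.m x * ∑ y ∈ G.neighbors x, G.μ x y * (f y - f x)

/-- The carré du champ operator `Γ(f, g) = (Δ(fg) - f Δg - g Δf) / 2`. -/
noncomputable def Gam {V : Type*} (G : WeightedGraph V) (f g : V → ℝ) : V → ℝ :=
  fun x => 1 / 2 * (G.laplacian (fun y => f y * g y) x
    - f x * G.laplacian g x - g x * G.laplacian f x)

/-- The iterated operator `Γ₂(f) = Δ Γ(f) / 2 - Γ(f, Δf)`, where `Γ(f) = Γ(f, f)`. -/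
noncomputable def Gam₂ {V : Type*} (G : WeightedGraph V) (f : V → ℝ) : V → ℝ :=
  fun x => 1 / 2 * G.laplacian (G.Gam f f) x - G.Gam f (G.laplacian f) x

/-- The curvature dimension condition `CD(K, n)`, for `K ∈ ℝ` and `n ∈ (0, ∞]`; here `1/∞ = 0`. -/
def CD {V : Type*} (G : WeightedGraph V) (K : ℝ) (n : ℝ≥0∞) : Prop :=
  ∀ (f : V → ℝ) (x : V),
    (n⁻¹).toReal * (G.laplacian f x) ^ 2 + K * G.Gam f f x ≤ G.Gam₂ f x

/-- Membership of a real function in `ℓ²(V, m)`. -/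
def MemL2 {V : Type*} (G : WeightedGraph V) (f : V → ℝ) : Prop :=
  Summable fun x => f x ^ 2 * G.m x

/-- The norm of `ℓ²(V, m)`, meaningful for functions in `ℓ²(V, m)`. -/
noncomputable def normL2 {V : Type*} (G : WeightedGraph V) (f : V → ℝ) : ℝ :=
  Real.sqrt (∑' x, f x ^ 2 * G.m x)

/-- The Laplacian is a bounded operator on `ℓ²(V, m)`. -/
def BoundedLaplacian {V : Type*} (G : WeightedGraph V) : Prop :=
  ∃ C : ℝ, ∀ f : V → ℝ, G.MemL2 f →
    G.MemL2 (G.laplacian f) ∧ G.normL2 (G.laplacian f) ≤ C * G.normL2 f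

/-- Completeness: there is a non-decreasing sequence of finitely supported non-negative functions
`η₁ ≤ η₂ ≤ …` converging pointwise to `1`, with `Γ(η_k) ≤ 1/k` (here `η k` stands for
`η_{k+1}`). -/
def Complete {V : Type*} (G : WeightedGraph V) : Prop :=
  ∃ η : ℕ → V → ℝ, Monotone η ∧ (∀ k, (Function.support (η k)).Finite) ∧ (∀ k x, 0 ≤ η k x) ∧
    (∀ x, Tendsto (fun k => η k x) atTop (𝓝 1)) ∧
    ∀ k x, G.Gam (η k) (η k) x ≤ 1 / ((k : ℝ) + 1)

/-- The vertex weight is bounded below by a positive constant, `inf m > 0`. -/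
def NonDegenerate {V : Type*} (G : WeightedGraph V) : Prop :=
  ∃ c : ℝ, 0 < c ∧ ∀ x, c ≤ G.m x

/-- The assumption (A). -/
def AssumptionA {V : Type*} (G : WeightedGraph V) : Prop :=
  G.BoundedLaplacian ∨ (G.Complete ∧ G.NonDegenerate)

/-- A function is harmonic if its Laplacian vanishes at every vertex. -/
def IsHarmonic {V : Type*} (G : WeightedGraph V) (f : V → ℝ) : Prop :=
  ∀ x, G.laplacian f x = 0

end WeightedGraph

namespace WeightedGraph

variable {V : Type*} (G : WeightedGraph V)

/-! By connectedness it suffices that `Γ(f) = 0`. Under CD(0,∞) a Markov averaging process gains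
gradient control at each step, so a bounded function that it leaves fixed can have no gradient.

Bounded Laplacian: weighted degrees are at most some `D`, and `1 + Δ/D` is an averaging operator.
Since `Δf² = 2Γ(f)` and `ΔΓ(f) ≥ 0`, iteration gives `f² + (2n/D) Γ(f) ≤ C²` for every `n`
(`Gam_eq_zero_of_deg_le`).

Complete case: the averaging operator is the resolvent `R = (1 - εΔ)⁻¹` on `ℓ²(V, m)`. Images under
`R` have finite norm and energy, so, as `inf m > 0`, they and their `Γ` vanish at infinity and a
minimum principle applies. It yields the gradient bound `sup Γ(Rh) ≤ sup Γ(h)`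
(`IsResolvent.Gam_le`) and `2ε Γ(R²h) ≤ sup h²` (`IsResolvent.reverse_poincare`). For the cutoffs
`η_k`, the gradient bound gives `R²η_k → 1`, and `|f - R²(fη_k)| ≤ C (1 - R²η_k)`, so `R²(fη_k) →
f`. Hence `2ε Γ(f) ≤ C²` for every `ε > 0`. -/

theorem mem_neighbors {x y : V} : y ∈ G.neighbors x ↔ G.graph.Adj x y := by
  simp [neighbors]

theorem μ_nonneg (x y : V) : 0 ≤ G.μ x y := by
  by_cases h : G.graph.Adj x y
  · exact (G.μ_pos x y h).le
  · exact (G.μ_eq_zero x y h).ge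

/-- The weighted degree `(1/m(x)) ∑_{y ∼ x} μ_{xy}`. -/
noncomputable def deg (x : V) : ℝ := 1 / G.m x * ∑ y ∈ G.neighbors x, G.μ x y

theorem deg_nonneg (x : V) : 0 ≤ G.deg x :=
  mul_nonneg (one_div_pos.2 (G.m_pos x)).le (Finset.sum_nonneg fun y _ => G.μ_nonneg x y)

/-! ### Calculus of `Δ` and `Γ` -/

theorem laplacian_add (f g : V → ℝ) (x : V) :
    G.laplacian (fun y => f y + g y) x = G.laplacian f x + G.laplacian g x := by
  simp only [laplacian]
  rw [← mul_add, ← Finset.sum_add_distrib]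
  congr 1
  exact Finset.sum_congr rfl fun y _ => by ring

theorem laplacian_const_mul (c : ℝ) (f : V → ℝ) (x : V) :
    G.laplacian (fun y => c * f y) x = c * G.laplacian f x := by
  simp only [laplacian, Finset.mul_sum]
  exact Finset.sum_congr rfl fun y _ => by ring

theorem laplacian_const (c : ℝ) (x : V) : G.laplacian (fun _ => c) x = 0 := by
  simp [laplacian]

theorem laplacian_sub (f g : V → ℝ) (x : V) :
    G.laplacian (fun y => f y - g y) x = G.laplacian f x - G.laplacian g x := by
  simp only [laplacian]
  rw [← mul_sub, ← Finset.sum_sub_distrib]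
  congr 1
  exact Finset.sum_congr rfl fun y _ => by ring

theorem laplacian_nonneg_of_isMin (f : V → ℝ) (x : V) (h : ∀ y, f x ≤ f y) :
    0 ≤ G.laplacian f x :=
  mul_nonneg (one_div_pos.2 (G.m_pos x)).le
    (Finset.sum_nonneg fun y _ => mul_nonneg (G.μ_nonneg x y) (sub_nonneg.2 (h y)))

theorem laplacian_le_of_le (f : V → ℝ) (M : ℝ) (h : ∀ y, f y ≤ M) (x : V) :
    G.laplacian f x ≤ G.deg x * (M - f x) := by
  have hm := (one_div_pos.2 (G.m_pos x)).le
  rw [laplacian, deg, mul_assoc, Finset.sum_mul]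
  gcongr with y
  · exact G.μ_nonneg x y
  · exact h y

theorem Gam_eq (f g : V → ℝ) (x : V) :
    G.Gam f g x =
      1 / (2 * G.m x) * ∑ y ∈ G.neighbors x, G.μ x y * ((f y - f x) * (g y - g x)) := by
  have h : ∑ y ∈ G.neighbors x, G.μ x y * ((f y - f x) * (g y - g x)) =
      ∑ y ∈ G.neighbors x, G.μ x y * (f y * g y - f x * g x)
        - f x * ∑ y ∈ G.neighbors x, G.μ x y * (g y - g x)
        - g x * ∑ y ∈ G.neighbors x, G.μ x y * (f y - f x) := by
    rw [Finset.mul_sum, Finset.mul_sum, ← Finset.sum_sub_distrib, ← Finset.sum_sub_distrib]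
    exact Finset.sum_congr rfl fun y _ => by ring
  have hm := (G.m_pos x).ne'
  rw [h, Gam, laplacian, laplacian, laplacian]
  field_simp

theorem Gam_self_nonneg (f : V → ℝ) (x : V) : 0 ≤ G.Gam f f x := by
  rw [Gam_eq]
  have := G.m_pos x
  exact mul_nonneg (by positivity)
    (Finset.sum_nonneg fun y _ => mul_nonneg (G.μ_nonneg x y) (mul_self_nonneg _))

theorem Gam_sub_mul_self (f g : V → ℝ) (c : ℝ) (x : V) :
    G.Gam (fun y => f y - c * g y) (fun y => f y - c * g y) x =
      G.Gam f f x - 2 * c * G.Gam f g x + c ^ 2 * G.Gam g g x := by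
  simp only [Gam_eq, Finset.mul_sum]
  rw [← Finset.sum_sub_distrib, ← Finset.sum_add_distrib]
  exact Finset.sum_congr rfl fun y _ => by ring

theorem laplacian_mul_self (f : V → ℝ) (x : V) :
    G.laplacian (fun y => f y * f y) x = 2 * G.Gam f f x + 2 * f x * G.laplacian f x := by
  rw [Gam]; ring

/-- Cauchy–Schwarz with weights `μ`. It turns a gradient bound into a pointwise bound on `Δ`. -/
theorem sq_laplacian_le (f : V → ℝ) (x : V) :
    G.laplacian f x ^ 2 ≤ 2 * G.deg x * G.Gam f f x := by
  have hm := G.m_pos x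
  have hcs := Finset.sum_mul_sq_le_sq_mul_sq (G.neighbors x) (fun y => √(G.μ x y))
    (fun y => √(G.μ x y) * (f y - f x))
  simp only [mul_pow, Real.sq_sqrt (G.μ_nonneg x _), ← mul_assoc,
    Real.mul_self_sqrt (G.μ_nonneg x _)] at hcs
  rw [laplacian, Gam_eq, deg, mul_pow]
  calc (1 / G.m x) ^ 2 * (∑ y ∈ G.neighbors x, G.μ x y * (f y - f x)) ^ 2
      ≤ (1 / G.m x) ^ 2 * ((∑ y ∈ G.neighbors x, G.μ x y) *
          ∑ y ∈ G.neighbors x, G.μ x y * (f y - f x) ^ 2) := by gcongr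
    _ = _ := by
        simp only [pow_two]
        field_simp

theorem eq_const_of_Gam_eq_zero (hconn : G.graph.Connected) (f : V → ℝ)
    (h : ∀ x, G.Gam f f x = 0) : ∃ c : ℝ, ∀ x, f x = c := by
  have hadj : ∀ x y, G.graph.Adj x y → f x = f y := by
    intro x y hxy
    have h0 := h x
    have hm := G.m_pos x
    rw [Gam_eq, mul_eq_zero, or_iff_right (by positivity), Finset.sum_eq_zero_iff_of_nonneg
      fun y _ => mul_nonneg (G.μ_nonneg x y) (mul_self_nonneg _)] at h0
    have h1 := h0 y (G.mem_neighbors.2 hxy)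
    rw [mul_eq_zero, or_iff_right (G.μ_pos x y hxy).ne', mul_self_eq_zero] at h1
    linarith
  obtain ⟨x₀⟩ := hconn.nonempty
  refine ⟨f x₀, fun x => ?_⟩
  obtain ⟨w⟩ := hconn.preconnected x x₀
  induction w with
  | nil => rfl
  | cons hab _ ih => exact (hadj _ _ hab).trans ih

variable {G} in
theorem CD.Gam₂_nonneg (hCD : G.CD 0 ⊤) (f : V → ℝ) (x : V) : 0 ≤ G.Gam₂ f x := by
  simpa using hCD f x

/-! ### The case of a bounded Laplacian -/

variable {G} in
theorem BoundedLaplacian.deg_le (h : G.BoundedLaplacian) : ∃ D : ℝ, 0 < D ∧ ∀ x, G.deg x ≤ D := by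
  classical
  obtain ⟨C, hC⟩ := h
  refine ⟨|C| + 1, by positivity, fun x => ?_⟩
  have hm := G.m_pos x
  -- The value of `Δδ` at `x` alone gives `‖Δδ‖ ≥ deg x · √m(x)`, while `‖δ‖ = √m(x)`.
  let δ : V → ℝ := Pi.single x 1
  have hδ : ∀ y, y ≠ x → δ y ^ 2 * G.m y = 0 := fun y hy => by simp [δ, hy]
  have hmem : G.MemL2 δ := summable_of_ne_finset_zero (s := {x}) fun y hy => hδ y (by simpa using hy)
  obtain ⟨h1, h2⟩ := hC δ hmem
  have hnorm : G.normL2 δ = √(G.m x) := by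
    rw [normL2, tsum_eq_single x hδ]
    simp [δ]
  have hlap : G.laplacian δ x = -G.deg x := by
    rw [laplacian, deg, ← mul_neg, ← Finset.sum_neg_distrib]
    congr 1
    refine Finset.sum_congr rfl fun y hy => ?_
    have : y ≠ x := (G.mem_neighbors.1 hy).ne'
    simp [δ, this]
  have h3 : G.deg x * √(G.m x) ≤ G.normL2 (G.laplacian δ) := by
    refine Real.le_sqrt_of_sq_le ?_
    have := h1.le_tsum x fun y _ => mul_nonneg (sq_nonneg _) (G.m_pos y).le
    rw [hlap] at this
    rw [mul_pow, Real.sq_sqrt hm.le]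
    linarith
  rw [hnorm] at h2
  have h4 : G.deg x ≤ C := le_of_mul_le_mul_right (h3.trans h2) (Real.sqrt_pos.2 hm)
  linarith [le_abs_self C]

/-- Along a harmonic function, `Γ(f)` is subharmonic and `Δ f² = 2 Γ(f)`; averaging with the Markov
operator `1 + Δ / D` therefore improves the bound on `f² + (2 n / D) Γ(f)` by one step. -/
theorem Gam_eq_zero_of_deg_le (hCD : G.CD 0 ⊤) {D : ℝ} (hD : 0 < D) (hdeg : ∀ x, G.deg x ≤ D)
    (f : V → ℝ) (hf : G.IsHarmonic f) (C : ℝ) (hC : ∀ x, |f x| ≤ C) (x : V) :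
    G.Gam f f x = 0 := by
  have hsq : ∀ x, f x * f x ≤ C ^ 2 := fun x => by
    rw [← pow_two]; exact sq_le_sq' (abs_le.1 (hC x)).1 (abs_le.1 (hC x)).2
  have hsub : ∀ x, 0 ≤ G.laplacian (G.Gam f f) x := by
    intro x
    have h1 := hCD.Gam₂_nonneg f x
    have h2 : G.laplacian f = fun _ => 0 := funext hf
    rw [Gam₂, h2, Gam_eq] at h1
    simpa using h1
  have key : ∀ (n : ℕ) (x : V), f x * f x + 2 * n / D * G.Gam f f x ≤ C ^ 2 := by
    intro n
    induction n with
    | zero => intro x; simpa using hsq x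
    | succ n ih =>
      intro x
      -- For `F = f² + (2n/D) Γ(f)`, `2Γ(f) ≤ ΔF ≤ D (C² - F)`, the second inequality because `F ≤
      -- C²` everywhere.
      have h1 := G.laplacian_le_of_le _ _ ih x
      rw [laplacian_add, laplacian_const_mul, laplacian_mul_self, hf x, mul_zero, add_zero] at h1
      have h2 := mul_le_mul_of_nonneg_right (hdeg x) (sub_nonneg.2 (ih x))
      have h3 : 0 ≤ 2 * (n : ℝ) / D * G.laplacian (G.Gam f f) x :=
        mul_nonneg (by positivity) (hsub x)
      have h4 : 2 * G.Gam f f x / D ≤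
          C ^ 2 - (f x * f x + 2 * n / D * G.Gam f f x) := by
        rw [div_le_iff₀ hD]; linarith
      push_cast
      calc _ = 2 * G.Gam f f x / D + (f x * f x + 2 * n / D * G.Gam f f x) := by ring
        _ ≤ _ := by linarith
  by_contra hne
  have hpos : 0 < G.Gam f f x := lt_of_le_of_ne (G.Gam_self_nonneg f x) (Ne.symm hne)
  obtain ⟨n, hn⟩ := exists_nat_gt (C ^ 2 / (2 / D * G.Gam f f x))
  rw [div_lt_iff₀ (by positivity)] at hn
  have := key n x
  have h5 : 2 * n / D * G.Gam f f x = n * (2 / D * G.Gam f f x) := by ring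
  nlinarith [mul_self_nonneg (f x)]

/-! ### Decay at infinity and the minimum principle -/

/-- Minimum principle for functions whose negative part vanishes at infinity. -/
theorem nonneg_of_sub_laplacian_nonneg {ε : ℝ} (hε : 0 ≤ ε) {z w : V → ℝ}
    (hw : Tendsto w cofinite (𝓝 0)) (hzw : ∀ x, -w x ≤ z x)
    (hz : ∀ x, 0 ≤ z x - ε * G.laplacian z x) (x : V) : 0 ≤ z x := by
  by_contra! hx
  -- Where `z ≤ z x < 0`, the function `w` stays above `-z x > 0`, which happens at finitely many
  -- points only. Hence `z` attains a global minimum.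
  have hfin : {y | z y ≤ z x}.Finite := by
    have h := hw.eventually_lt_const (neg_pos.2 hx)
    rw [eventually_cofinite] at h
    refine h.subset fun y hy => ?_
    have := hzw y
    simp only [Set.mem_ofPred_eq] at hy ⊢
    linarith
  obtain ⟨y, hy, hmin⟩ := Set.exists_min_image _ z hfin ⟨x, le_refl (z x)⟩
  have hglob : ∀ v, z y ≤ z v := fun v => by
    by_cases hv : z v ≤ z x
    · exact hmin v hv
    · exact le_trans hy (not_le.1 hv).le
  have h1 := mul_nonneg hε (G.laplacian_nonneg_of_isMin z y hglob)
  have h2 := hz y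
  have h3 : z y ≤ z x := hy
  linarith

-- This is where `inf m > 0` enters: summability against `m` forces decay at infinity.
variable {G} in
theorem NonDegenerate.tendsto_of_summable (hG : G.NonDegenerate) {g : V → ℝ} (hg : ∀ x, 0 ≤ g x)
    (h : Summable fun x => g x * G.m x) : Tendsto g cofinite (𝓝 0) := by
  obtain ⟨c, hc, hm⟩ := hG
  have h1 := h.tendsto_cofinite_zero.div_const c
  rw [zero_div] at h1
  refine squeeze_zero hg (fun x => ?_) h1
  rw [le_div_iff₀ hc]
  exact mul_le_mul_of_nonneg_left (hm x) (hg x)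

variable {G} in
theorem MemL2.tendsto (hG : G.NonDegenerate) {u : V → ℝ} (hu : G.MemL2 u) :
    Tendsto u cofinite (𝓝 0) := by
  have h := (hG.tendsto_of_summable (fun x => sq_nonneg (u x)) hu).sqrt
  simp only [Real.sqrt_sq_eq_abs, Real.sqrt_zero] at h
  exact (tendsto_zero_iff_abs_tendsto_zero u).2 h

theorem memL2_of_finite_support {u : V → ℝ} (hu : (Function.support u).Finite) : G.MemL2 u := by
  refine summable_of_hasFiniteSupport (hu.subset fun x hx => ?_)
  contrapose! hx
  simp [Function.notMem_support.1 hx]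

/-! ### Existence of the resolvent by orthogonal projection -/

/-- `u` has finite norm and energy and solves `u - ε Δ u = h`. -/
structure IsResolvent (ε : ℝ) (h u : V → ℝ) : Prop where
  memL2 : G.MemL2 u
  energy : Summable fun x => G.Gam u u x * G.m x
  eq : ∀ x, u x - ε * G.laplacian u x = h x

/-- The graph of the (scaled) weighted gradient, as a closed subspace of an `ℓ²` space. -/
noncomputable def gradientGraph (ε : ℝ) :
    Submodule ℝ (lp (fun _ : V ⊕ V × V => ℝ) 2) where
  carrier := {ξ | ∀ x y, ξ (Sum.inr (x, y)) = √(ε * G.μ x y / 2) *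
    (ξ (Sum.inl y) / √(G.m y) - ξ (Sum.inl x) / √(G.m x))}
  add_mem' := by
    intro a b ha hb x y
    simp only [lp.coeFn_add, Pi.add_apply, ha x y, hb x y]
    ring
  zero_mem' := by intro x y; simp
  smul_mem' := by
    intro c a ha x y
    simp only [lp.coeFn_smul, Pi.smul_apply, smul_eq_mul, ha x y]
    ring

theorem isClosed_gradientGraph (ε : ℝ) :
    IsClosed (G.gradientGraph ε : Set (lp (fun _ : V ⊕ V × V => ℝ) 2)) := by
  have hc : ∀ i, Continuous fun ξ : lp (fun _ : V ⊕ V × V => ℝ) 2 => ξ i := fun i =>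
    (continuous_apply i).comp lp.uniformContinuous_coe.continuous
  have : (G.gradientGraph ε : Set (lp (fun _ : V ⊕ V × V => ℝ) 2)) =
      ⋂ x, ⋂ y, {ξ | ξ (Sum.inr (x, y)) = √(ε * G.μ x y / 2) *
        (ξ (Sum.inl y) / √(G.m y) - ξ (Sum.inl x) / √(G.m x))} := by
    ext ξ
    simp only [Set.mem_iInter]
    rfl
  rw [this]
  refine isClosed_iInter fun x => isClosed_iInter fun y => isClosed_eq (hc _) ?_
  exact continuous_const.mul (((hc _).div_const _).sub ((hc _).div_const _))

open Classical in
/-- The element of `gradientGraph` which comes from the indicator function of a vertex. -/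
noncomputable def gradientSingle (ε : ℝ) (x : V) : lp (fun _ : V ⊕ V × V => ℝ) 2 :=
  lp.single 2 (Sum.inl x) √(G.m x) + ∑ y ∈ G.neighbors x,
    (lp.single 2 (Sum.inr (y, x)) √(ε * G.μ x y / 2) -
      lp.single 2 (Sum.inr (x, y)) √(ε * G.μ x y / 2))

open Classical in
theorem gradientSingle_apply (ε : ℝ) (x : V) (i : V ⊕ V × V) :
    G.gradientSingle ε x i = (if i = Sum.inl x then √(G.m x) else 0) + ∑ y ∈ G.neighbors x,
      ((if i = Sum.inr (y, x) then √(ε * G.μ x y / 2) else 0) -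
        (if i = Sum.inr (x, y) then √(ε * G.μ x y / 2) else 0)) := by
  rw [gradientSingle, lp.coeFn_add, Pi.add_apply, lp.coeFn_sum]
  refine congrArg₂ _ (by simp [lp.single_apply, Pi.single_apply])
    ((Finset.sum_apply i _ _).trans (Finset.sum_congr rfl fun y _ => ?_))
  simp [lp.single_apply, Pi.single_apply]

theorem gradientSingle_inl (ε : ℝ) (x y : V) [Decidable (y = x)] :
    G.gradientSingle ε x (Sum.inl y) = if y = x then √(G.m x) else 0 := by
  simp [gradientSingle_apply]

theorem gradientSingle_inr (ε : ℝ) (x y z : V) [Decidable (y = x)] [Decidable (z = x)] :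
    G.gradientSingle ε x (Sum.inr (y, z)) =
      √(ε * G.μ y z / 2) * ((if z = x then 1 else 0) - (if y = x then 1 else 0)) := by
  classical
  have hnb : ∀ v, v ∉ G.neighbors x → √(ε * G.μ x v / 2) = 0 := fun v hv => by
    rw [G.μ_eq_zero x v fun h => hv (G.mem_neighbors.2 h)]
    simp
  have hs : ∀ (v : V) (c : Prop) [Decidable c],
      ∑ w ∈ G.neighbors x, (if v = w ∧ c then √(ε * G.μ x w / 2) else 0) =
        if c then √(ε * G.μ x v / 2) else 0 := by
    intro v c _
    by_cases hc : c
    · simp only [hc, and_true, if_true, Finset.sum_ite_eq]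
      split_ifs with hv
      · rfl
      · exact (hnb v hv).symm
    · simp [hc]
  have h1 : G.gradientSingle ε x (Sum.inr (y, z)) =
      (if z = x then √(ε * G.μ x y / 2) else 0) - if y = x then √(ε * G.μ x z / 2) else 0 := by
    rw [← hs y (z = x), ← hs z (y = x)]
    simp [gradientSingle_apply, and_comm]
  rw [h1, mul_sub]
  congr 1
  · split_ifs with h
    · rw [h, G.μ_symm x y, mul_one]
    · simp
  · split_ifs with h
    · rw [h, mul_one]
    · simp

theorem gradientSingle_mem (ε : ℝ) (x : V) : G.gradientSingle ε x ∈ G.gradientGraph ε := by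
  classical
  intro y z
  have hm := fun x => (Real.sqrt_pos.2 (G.m_pos x)).ne'
  rw [gradientSingle_inl, gradientSingle_inl, gradientSingle_inr]
  congr 2
  · split_ifs with h
    · rw [h, div_self (hm x)]
    · simp
  · split_ifs with h
    · rw [h, div_self (hm x)]
    · simp

theorem inner_gradientSingle (ε : ℝ) (x : V) (ξ : lp (fun _ : V ⊕ V × V => ℝ) 2) :
    inner ℝ (G.gradientSingle ε x) ξ = √(G.m x) * ξ (Sum.inl x) +
      ∑ y ∈ G.neighbors x,
        √(ε * G.μ x y / 2) * (ξ (Sum.inr (y, x)) - ξ (Sum.inr (x, y))) := by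
  classical
  rw [gradientSingle, inner_add_left, sum_inner]
  simp only [inner_sub_left, lp.inner_single_left, RCLike.inner_apply, conj_trivial]
  congr 1
  · ring
  · exact Finset.sum_congr rfl fun y _ => by ring

theorem exists_isResolvent {ε : ℝ} (hε : 0 < ε) {h : V → ℝ} (hh : G.MemL2 h) :
    ∃ u, G.IsResolvent ε h u := by
  have hsm := fun x => (Real.sqrt_pos.2 (G.m_pos x)).ne'
  have hmm := fun x => Real.mul_self_sqrt (G.m_pos x).le
  -- Projecting `(√m h, 0)` onto the gradient graph minimises `‖u - h‖² + ε ∑ m Γ(u)`. The factor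
  -- `1/2` in the graph compensates for counting each edge in both orientations.
  let ξ₀ : lp (fun _ : V ⊕ V × V => ℝ) 2 :=
    ⟨Sum.elim (fun x => √(G.m x) * h x) fun _ => 0, by
      refine memℓp_gen ((Sum.inl_injective.summable_iff fun i hi => ?_).1 ?_)
      · rcases i with i | i
        · exact absurd ⟨i, rfl⟩ hi
        · simp
      · refine Summable.congr hh fun x => ?_
        simp only [Function.comp, Sum.elim_inl, ENNReal.toReal_ofNat, Real.rpow_ofNat,
          Real.norm_eq_abs, sq_abs, mul_pow, Real.sq_sqrt (G.m_pos x).le]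
        ring⟩
  have : CompleteSpace (G.gradientGraph ε) := (G.isClosed_gradientGraph ε).completeSpace_coe
  let ξ := (G.gradientGraph ε).starProjection ξ₀
  let u : V → ℝ := fun x => ξ (Sum.inl x) / √(G.m x)
  have hξu : ∀ x, ξ (Sum.inl x) = √(G.m x) * u x := fun x => (mul_div_cancel₀ _ (hsm x)).symm
  have hξ : ∀ x y, ξ (Sum.inr (x, y)) = √(ε * G.μ x y / 2) * (u y - u x) :=
    Submodule.starProjection_apply_mem (G.gradientGraph ε) ξ₀
  have hμ : ∀ x y, √(ε * G.μ x y / 2) * √(ε * G.μ x y / 2) = ε * G.μ x y / 2 := fun x y =>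
    Real.mul_self_sqrt (div_nonneg (mul_nonneg hε.le (G.μ_nonneg x y)) two_pos.le)
  have hsum : Summable fun i => ξ i ^ 2 := by
    refine ((lp.memℓp ξ).summable (by simp)).congr fun i => ?_
    simp
  refine ⟨u, ?_, ?_, fun x => ?_⟩
  · refine (hsum.comp_injective Sum.inl_injective).congr fun x => ?_
    simp only [Function.comp, hξu, mul_pow, Real.sq_sqrt (G.m_pos x).le]
    ring
  · refine ((hsum.comp_injective Sum.inr_injective).prod.mul_left ε⁻¹).congr fun x => ?_
    rw [tsum_eq_sum (s := G.neighbors x) fun y hy => ?_, Gam_eq, Finset.mul_sum, Finset.mul_sum,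
      Finset.sum_mul]
    · refine Finset.sum_congr rfl fun y _ => ?_
      have := (G.m_pos x).ne'
      simp only [Function.comp, hξ, mul_pow]
      rw [pow_two √_, hμ]
      field_simp
    · simp [hξ, G.μ_eq_zero x y fun h => hy (G.mem_neighbors.2 h)]
  · have hort := Submodule.starProjection_inner_eq_zero ξ₀ _ (G.gradientSingle_mem ε x)
    rw [real_inner_comm, inner_sub_right, inner_gradientSingle, inner_gradientSingle] at hort
    have h0 : ∑ y ∈ G.neighbors x, √(ε * G.μ x y / 2) *
        (ξ₀ (Sum.inr (y, x)) - ξ₀ (Sum.inr (x, y))) = 0 := by simp [ξ₀]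
    have h1 : ∑ y ∈ G.neighbors x, √(ε * G.μ x y / 2) *
        (ξ (Sum.inr (y, x)) - ξ (Sum.inr (x, y))) = -(ε * (G.m x * G.laplacian u x)) := by
      rw [laplacian, ← mul_assoc (G.m x), mul_one_div_cancel (G.m_pos x).ne', one_mul,
        Finset.mul_sum, ← Finset.sum_neg_distrib]
      refine Finset.sum_congr rfl fun y _ => ?_
      rw [hξ, hξ, G.μ_symm y x]
      linear_combination (2 * (u x - u y)) * hμ x y
    have h2 : ξ₀ (Sum.inl x) = √(G.m x) * h x := rfl
    change √(G.m x) * ξ₀ (Sum.inl x) + _ - (√(G.m x) * ξ (Sum.inl x) + _) = 0 at hort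
    rw [h0, h1, h2, hξu] at hort
    refine mul_left_cancel₀ (G.m_pos x).ne' ?_
    linear_combination (h x - u x) * hmm x - hort

/-! ### Resolvent estimates under CD(0,∞) -/

variable {G}

/-- Expand `Γ(h) = Γ(u) - 2ε Γ(u, Δu) + ε² Γ(Δu)`, drop the last term, and use `Γ₂(u) ≥ 0` in the
form `2Γ(u, Δu) ≤ ΔΓ(u)`. -/
theorem IsResolvent.Gam_sub_laplacian_le {ε : ℝ} (hε : 0 ≤ ε) (hCD : G.CD 0 ⊤) {h u : V → ℝ}
    (hu : G.IsResolvent ε h u) (x : V) :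
    G.Gam u u x - ε * G.laplacian (G.Gam u u) x ≤ G.Gam h h x := by
  have h1 : h = fun y => u y - ε * G.laplacian u y := funext fun y => (hu.eq y).symm
  have h2 := hCD.Gam₂_nonneg u x
  rw [Gam₂] at h2
  rw [h1, Gam_sub_mul_self]
  have h3 := mul_nonneg (sq_nonneg ε) (G.Gam_self_nonneg (G.laplacian u) x)
  have h4 := mul_nonneg hε h2
  linarith

theorem IsResolvent.tendsto_Gam {ε : ℝ} (hG : G.NonDegenerate) {h u : V → ℝ}
    (hu : G.IsResolvent ε h u) : Tendsto (G.Gam u u) cofinite (𝓝 0) :=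
  hG.tendsto_of_summable (G.Gam_self_nonneg u) hu.energy

theorem IsResolvent.Gam_le {ε : ℝ} (hε : 0 ≤ ε) (hCD : G.CD 0 ⊤) (hG : G.NonDegenerate)
    {h u : V → ℝ} (hu : G.IsResolvent ε h u) {B : ℝ} (hB : 0 ≤ B) (hh : ∀ x, G.Gam h h x ≤ B)
    (x : V) : G.Gam u u x ≤ B := by
  refine sub_nonneg.1 (G.nonneg_of_sub_laplacian_nonneg hε (z := fun y => B - G.Gam u u y)
    (hu.tendsto_Gam hG) (fun y => by linarith) (fun y => ?_) x)
  rw [laplacian_sub, laplacian_const]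
  have := hu.Gam_sub_laplacian_le hε hCD y
  linarith [hh y]

/-- The resolvent maps `f`, up to an error controlled by `1 - η`, to itself if `f` is harmonic. -/
theorem IsResolvent.sub_le {ε : ℝ} (hε : 0 ≤ ε) (hG : G.NonDegenerate) {f : V → ℝ}
    (hf : G.IsHarmonic f) {C : ℝ} (hC : ∀ x, f x ≤ C) {η a h p : V → ℝ}
    (ha : G.IsResolvent ε η a) (hp : G.IsResolvent ε h p)
    (hh : ∀ x, f x - h x ≤ C * (1 - η x)) (x : V) : f x - p x ≤ C * (1 - a x) := by
  -- Although `f` need not decay, `C - f ≥ 0`, so the negative part of `(C - f) - (C a - p)` is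
  -- controlled by `C a - p`, which does.
  have hlim : Tendsto (fun x => C * a x - p x) cofinite (𝓝 0) := by
    simpa using ((ha.memL2.tendsto hG).const_mul C).sub (hp.memL2.tendsto hG)
  refine sub_nonneg.1 (G.nonneg_of_sub_laplacian_nonneg hε
    (z := fun y => C * (1 - a y) - (f y - p y)) hlim (fun y => by linarith [hC y])
    (fun y => ?_) x)
  rw [laplacian_sub, laplacian_const_mul, laplacian_sub, laplacian_sub, laplacian_const, hf y]
  have h1 := hh y
  rw [← ha.eq y, ← hp.eq y] at h1
  linarith

theorem IsHarmonic.neg {f : V → ℝ} (hf : G.IsHarmonic f) : G.IsHarmonic fun x => -f x := by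
  intro x
  have := G.laplacian_const_mul (-1) f x
  simpa [hf x] using this

theorem IsResolvent.neg {ε : ℝ} {h u : V → ℝ} (hu : G.IsResolvent ε h u) :
    G.IsResolvent ε (fun x => -h x) fun x => -u x where
  memL2 := by simpa [MemL2] using hu.memL2
  energy := by
    refine hu.energy.congr fun x => ?_
    rw [Gam_eq, Gam_eq]
    congr 2
    exact Finset.sum_congr rfl fun y _ => by ring
  eq x := by
    have := G.laplacian_const_mul (-1) u x
    simp only [neg_one_mul] at this
    rw [this, ← hu.eq x]
    ring

theorem IsResolvent.abs_sub_le {ε : ℝ} (hε : 0 ≤ ε) (hG : G.NonDegenerate) {f : V → ℝ}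
    (hf : G.IsHarmonic f) {C : ℝ} (hC : ∀ x, |f x| ≤ C) {η a h p : V → ℝ}
    (ha : G.IsResolvent ε η a) (hp : G.IsResolvent ε h p)
    (hh : ∀ x, |f x - h x| ≤ C * (1 - η x)) (x : V) : |f x - p x| ≤ C * (1 - a x) := by
  rw [abs_le']
  refine ⟨ha.sub_le hε hG hf (fun y => (abs_le.1 (hC y)).2) hp
    (fun y => (le_abs_self _).trans (hh y)) x, ?_⟩
  have := ha.sub_le hε hG hf.neg (fun y => neg_le.1 (abs_le.1 (hC y)).1) hp.neg
    (fun y => by linarith [(neg_le_abs (f y - h y)).trans (hh y)]) x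
  linarith

/-- Reverse Poincaré inequality for the squared resolvent. -/
theorem IsResolvent.reverse_poincare {ε : ℝ} (hε : 0 ≤ ε) (hCD : G.CD 0 ⊤)
    (hG : G.NonDegenerate) {h p q : V → ℝ} (hp : G.IsResolvent ε h p)
    (hq : G.IsResolvent ε p q) {C : ℝ} (hC : ∀ x, |h x| ≤ C) (x : V) :
    2 * ε * G.Gam q q x ≤ C ^ 2 := by
  have hlim : Tendsto (fun x => p x * p x + 2 * ε * G.Gam q q x) cofinite (𝓝 0) := by
    have h1 := hp.memL2.tendsto hG
    simpa using (h1.mul h1).add ((hq.tendsto_Gam hG).const_mul (2 * ε))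
  have key := G.nonneg_of_sub_laplacian_nonneg hε
    (z := fun y => C ^ 2 - (p y * p y + 2 * ε * G.Gam q q y)) hlim
    (fun y => by linarith [sq_nonneg C]) (fun y => ?_) x
  · linarith [mul_self_nonneg (p x)]
  -- Since `Γ(q) - εΔΓ(q) ≤ Γ(p)`, the `Γ(p)` terms cancel and `1 - εΔ` sends `p² + 2εΓ(q)` to at
  -- most `p² - 2εpΔp = h² - (εΔp)² ≤ C²`.
  rw [laplacian_sub, laplacian_const, laplacian_add, laplacian_const_mul, laplacian_mul_self]
  have h1 := mul_le_mul_of_nonneg_left (hq.Gam_sub_laplacian_le hε hCD y) hε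
  have h2 : h y ^ 2 ≤ C ^ 2 := sq_le_sq' (abs_le.1 (hC y)).1 (abs_le.1 (hC y)).2
  have h3 := sq_nonneg (ε * G.laplacian p y)
  rw [← hp.eq y] at h2
  linarith

/-- As `a k = η k + ε Δ(a k)`, it suffices that `Δ(a k) → 0` pointwise. The gradient bound and
Cauchy–Schwarz give `(Δ(a k))² ≤ 2 deg / (k + 1)`. -/
theorem IsResolvent.tendsto_one {ε : ℝ} (hε : 0 ≤ ε) (hCD : G.CD 0 ⊤) (hG : G.NonDegenerate)
    {η a : ℕ → V → ℝ} (ha : ∀ k, G.IsResolvent ε (η k) (a k))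
    (hη : ∀ k x, G.Gam (η k) (η k) x ≤ 1 / ((k : ℝ) + 1))
    {x : V} (hlim : Tendsto (fun k => η k x) atTop (𝓝 1)) :
    Tendsto (fun k => a k x) atTop (𝓝 1) := by
  have h1 : Tendsto (fun k => G.laplacian (a k) x) atTop (𝓝 0) := by
    refine (tendsto_zero_iff_abs_tendsto_zero _).2 ?_
    have h2 : Tendsto (fun k : ℕ => √(2 * G.deg x * (1 / ((k : ℝ) + 1)))) atTop (𝓝 0) := by
      simpa using (tendsto_one_div_add_atTop_nhds_zero_nat.const_mul (2 * G.deg x)).sqrt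
    refine squeeze_zero (fun k => abs_nonneg _) (fun k => Real.abs_le_sqrt ?_) h2
    refine (G.sq_laplacian_le (a k) x).trans ?_
    have := G.deg_nonneg x
    gcongr
    exact (ha k).Gam_le hε hCD hG (by positivity) (hη k) x
  have h3 := hlim.add (h1.const_mul ε)
  simp only [mul_zero, add_zero] at h3
  refine h3.congr fun k => ?_
  rw [← (ha k).eq x]
  ring

theorem tendsto_Gam_of_tendsto {q : ℕ → V → ℝ} {f : V → ℝ}
    (h : ∀ x, Tendsto (fun k => q k x) atTop (𝓝 (f x))) (x : V) :
    Tendsto (fun k => G.Gam (q k) (q k) x) atTop (𝓝 (G.Gam f f x)) := by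
  simp only [Gam_eq]
  refine Tendsto.const_mul _ (tendsto_finsetSum _ fun y _ => Tendsto.const_mul _ ?_)
  exact ((h y).sub (h x)).mul ((h y).sub (h x))

/-! ### Conclusion in the complete case -/

theorem Gam_le_of_complete (hCD : G.CD 0 ⊤) (hcompl : G.Complete) (hG : G.NonDegenerate)
    {f : V → ℝ} (hf : G.IsHarmonic f) {C : ℝ} (hC : ∀ x, |f x| ≤ C) {ε : ℝ} (hε : 0 < ε) (x : V) :
    2 * ε * G.Gam f f x ≤ C ^ 2 := by
  obtain ⟨η, hmono, hfin, hnn, hlim, hη⟩ := hcompl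
  have hη1 : ∀ k y, η k y ≤ 1 := fun k y =>
    Monotone.ge_of_tendsto (fun i j hij => hmono hij y) (hlim y) k
  have hsupp : ∀ k, (Function.support fun y => f y * η k y).Finite := fun k =>
    (hfin k).subset (Function.support_mul_subset_right _ _)
  choose a ha using fun k => G.exists_isResolvent hε (G.memL2_of_finite_support (hfin k))
  choose b hb using fun k => G.exists_isResolvent hε (ha k).memL2
  choose p hp using fun k => G.exists_isResolvent hε (G.memL2_of_finite_support (hsupp k))
  choose q hq using fun k => G.exists_isResolvent hε (hp k).memL2
  -- The resolvent preserves the bound on `Γ(η k)`, so `a k` can take the place of `η k` in the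
  -- second application.
  have hb1 : ∀ y, Tendsto (fun k => b k y) atTop (𝓝 1) := fun y =>
    IsResolvent.tendsto_one hε.le hCD hG hb
      (fun k => (ha k).Gam_le hε.le hCD hG (by positivity) (hη k))
      (IsResolvent.tendsto_one hε.le hCD hG ha hη (hlim y))
  have hfη : ∀ k y, |f y - f y * η k y| ≤ C * (1 - η k y) := fun k y => by
    have h1 : 0 ≤ 1 - η k y := sub_nonneg.2 (hη1 k y)
    rw [← mul_one_sub, abs_mul, abs_of_nonneg h1]
    exact mul_le_mul_of_nonneg_right (hC y) h1
  have hqf : ∀ y, Tendsto (fun k => q k y) atTop (𝓝 (f y)) := fun y => by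
    have h1 : Tendsto (fun k => C * (1 - b k y)) atTop (𝓝 0) := by
      simpa using ((hb1 y).const_sub 1).const_mul C
    refine tendsto_iff_norm_sub_tendsto_zero.2 (squeeze_zero (fun k => norm_nonneg _)
      (fun k => ?_) h1)
    rw [Real.norm_eq_abs, abs_sub_comm]
    exact (hb k).abs_sub_le hε.le hG hf hC (hq k)
      ((ha k).abs_sub_le hε.le hG hf hC (hp k) (hfη k)) y
  refine le_of_tendsto ((tendsto_Gam_of_tendsto hqf x).const_mul (2 * ε))
    (Eventually.of_forall fun k => (hp k).reverse_poincare hε.le hCD hG (hq k) (fun y => ?_) x)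
  rw [abs_mul, abs_of_nonneg (hnn k y)]
  exact (mul_le_of_le_one_right (abs_nonneg _) (hη1 k y)).trans (hC y)

theorem Gam_eq_zero_of_complete (hCD : G.CD 0 ⊤) (hcompl : G.Complete) (hG : G.NonDegenerate)
    {f : V → ℝ} (hf : G.IsHarmonic f) {C : ℝ} (hC : ∀ x, |f x| ≤ C) (x : V) :
    G.Gam f f x = 0 := by
  by_contra hne
  have hpos : 0 < G.Gam f f x := lt_of_le_of_ne (G.Gam_self_nonneg f x) (Ne.symm hne)
  -- This `ε` makes `2ε Γ(f) = 2(C² + 1)`, which exceeds `C²`.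
  have h := Gam_le_of_complete hCD hcompl hG hf hC
    (ε := (C ^ 2 + 1) / G.Gam f f x) (by positivity) x
  rw [mul_assoc, div_mul_cancel₀ _ hne] at h
  linarith [sq_nonneg C]

end WeightedGraph

theorem theorem1 {V : Type*} (G : WeightedGraph V) (hconn : G.graph.Connected)
    (hA : G.AssumptionA) (hCD : G.CD 0 ⊤)
    (f : V → ℝ) (hf : G.IsHarmonic f) (hbdd : ∃ C : ℝ, ∀ x, |f x| ≤ C) :
    ∃ c : ℝ, ∀ x, f x = c := by
  obtain ⟨C, hC⟩ := hbdd
  refine G.eq_const_of_Gam_eq_zero hconn f fun x => ?_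
  rcases hA with hA | ⟨hcompl, hnd⟩
  · obtain ⟨D, hD, hdeg⟩ := hA.deg_le
    exact G.Gam_eq_zero_of_deg_le hCD hD hdeg f hf C hC x
  · exact WeightedGraph.Gam_eq_zero_of_complete hCD hcompl hnd hf hC x
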